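/- An MV-algebra is an algebra $(M;\oplus,{}^*,0)$ such that $(M;\oplus,0)$ is a commutative monoid and, with $1:=0^*$, for all $x,y\in M$: $(x^*)^*=x$, $x\oplus 1=1$ and $x\oplus(x\oplus y^*)^*=y\oplus(y\oplus x^*)^*$. It is ordered by $x\le y$ iff $x^*\oplus y=1$, and it is $\sigma$-complete if every sequence has a supremum and an infimum. The partial sum $a+b$ is defined iff $a\le b^*$, and then $a+b:=a\oplus b$. A state on $M$ is a map $s:M\to[0,1]$ with $s(1)=1$ and $s(a+b)=s(a)+s(b)$ whenever $a+b$ is defined; it is $\sigma$-additive if $s(a)=\lim_n s(a_n)$ whenever $a_1\le a_2\le\cdots$ and $a=\bigvee_n a_n$. An element $e\in M$ is central if there is an isomorphism $\varphi:M\to[0,e]\times[0,e^*]$ with respect to the partial sums and units (the sum on $[0,e]$ being the restriction of $+$, and its unit being $e$; likewise for $[0,e^*]$) such that $\varphi(e)=(e,0)$ and such that $\varphi(x)=(x_1,x_2)$ implies $x=x_1+x_2$. A tribe on a set $X\neq\emptyset$ is a set $\mathcal T\subseteq[0,1]^X$ such that $1\in\mathcal T$, $1-f\in\mathcal T$ for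 $f\in\mathcal T$, and $\min\{\sum_{n=1}^\infty f_n,1\}\in\mathcal T$ for every sequence $(f_n)$ in $\mathcal T$; it is an MV-algebra with $f\oplus g=\min\{f+g,1\}$, $f^*=1-f$ and the pointwise order. Put $$\mathcal S_0(\mathcal T)=\{A\subseteq X:\chi_A\in\mathcal T\},\qquad \mathcal B_0(\mathcal T)=\{A\subseteq X:\chi_A \text{ is a central element of }\mathcal T\}.$$ A $\sigma$-MV-homomorphism is a map between MV-algebras that preserves $\oplus$, ${}^*$, $0$ and all existing countable suprema. **Theorem.** Let $s$ be a $\sigma$-additive state on a $\sigma$-complete MV-algebra $M$. Then there are a set $X\ne\emptyset$, a tribe $\mathcal T$ of functions on $X$ and a $\sigma$-MV-homomorphism $h$ from $\mathcal T$ onto $M$ such that $\mathcal B_0(\mathcal T)=\mathcal S_0(\mathcal T)$ is a $\sigma$-algebra of subsets of $X$, every $f\in\mathcal T$ is $\mathcal B_0(\mathcal T)$-measurable, and there is a unique $\sigma$-additive probability measure $\mu_s$ on $\mathcal B_0(\mathcal T)$ with $$s(a)=\int_X f(x)\,d\mu_s(x)\qquad\text{for all } a\in M \text{ and all } f\in\mathcal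 T \text{ with } h(f)=a.$$ -/

import Mathlib

open scoped unitInterval MeasureTheory

universe u

/-- An MV-algebra `(M; ⊕, *, 0)`, where `1 := 0*`. The order is not additional data: it is
determined by the operations through `le_iff` (that `x* ⊕ y = 1` is always a partial order is
`MVAlgebra.ofAxioms` below); it is a field only so that algebras of functions carry their
pointwise order definitionally. -/
class MVAlgebra (M : Type*) extends PartialOrder M where
  oplus : M → M → M
  neg : M → M
  zero : M
  oplus_assoc : ∀ x y z, oplus (oplus x y) z = oplus x (oplus y z)
  oplus_comm : ∀ x y, oplus x y = oplus y x
  oplus_zero : ∀ x, oplus x zero = x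
  neg_neg : ∀ x, neg (neg x) = x
  oplus_one : ∀ x, oplus x (neg zero) = neg zero
  luk : ∀ x y, oplus x (neg (oplus x (neg y))) = oplus y (neg (oplus y (neg x)))
  le_iff : ∀ x y, x ≤ y ↔ oplus (neg x) y = neg zero

namespace MVAlgebra

/-- The unit `1 = 0*`. -/
def one {M : Type*} [MVAlgebra M] : M := neg zero

/-- An algebra that satisfies just the algebraic axioms is an MV-algebra in the sense above. -/
abbrev ofAxioms {M : Type*} (oplus : M → M → M) (neg : M → M) (zero : M)
    (assoc : ∀ x y z, oplus (oplus x y) z = oplus x (oplus y z))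
    (comm : ∀ x y, oplus x y = oplus y x)
    (oplus_zero : ∀ x, oplus x zero = x)
    (neg_neg : ∀ x, neg (neg x) = x)
    (oplus_one : ∀ x, oplus x (neg zero) = neg zero)
    (luk : ∀ x y, oplus x (neg (oplus x (neg y))) = oplus y (neg (oplus y (neg x)))) :
    MVAlgebra M where
  le x y := oplus (neg x) y = neg zero
  le_refl x := by
    have h := luk x (neg zero)
    rw [neg_neg, oplus_zero, comm (neg zero) (neg (oplus _ _)), oplus_one] at h
    rw [comm, h]
  le_trans x y z hxy hyz := by
    have h := luk z y
    rw [comm z (neg y), hyz, neg_neg, oplus_zero] at h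
    rw [h, ← assoc, hxy, comm, oplus_one]
  le_antisymm x y hxy hyx := by
    have h := luk x y
    rw [comm x (neg y), hyx, comm y (neg x), hxy, neg_neg, oplus_zero, oplus_zero] at h
    exact h
  oplus := oplus
  neg := neg
  zero := zero
  oplus_assoc := assoc
  oplus_comm := comm
  oplus_zero := oplus_zero
  neg_neg := neg_neg
  oplus_one := oplus_one
  luk := luk
  le_iff _ _ := Iff.rfl

section

variable {M : Type*} [MVAlgebra M]

/-- The partial addition of the associated effect algebra: `a + b` is defined iff `a ≤ b*`, and
then it is `a ⊕ b`. `IsSum a b c` says that `a + b` is defined and equal to `c`. -/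
def IsSum (a b c : M) : Prop := a ≤ neg b ∧ oplus a b = c

/-- Central elements: there is an isomorphism of effect algebras `φ : M → [0,e] × [0,e*]` with
`φ e = (e, 0)` and such that `φ x = (x₁, x₂)` implies `x = x₁ + x₂`. The addition of `[0,e]` is the
restriction of that of `M`, its unit is `e`. -/
def IsCentral (e : M) : Prop :=
  ∃ φ : M ≃ Set.Iic e × Set.Iic (neg e),
    (((φ one).1 : M) = e ∧ ((φ one).2 : M) = neg e) ∧
    (∀ a b c : M, IsSum a b c ↔
      IsSum ((φ a).1 : M) (φ b).1 (φ c).1 ∧ IsSum ((φ a).2 : M) (φ b).2 (φ c).2) ∧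
    (((φ e).1 : M) = e ∧ ((φ e).2 : M) = zero) ∧
    ∀ x : M, IsSum ((φ x).1 : M) (φ x).2 x

/-- States on an MV-algebra. -/
structure IsState (s : M → ℝ) : Prop where
  mem_Icc : ∀ a, s a ∈ Set.Icc (0 : ℝ) 1
  map_one : s one = 1
  map_sum : ∀ a b c, IsSum a b c → s c = s a + s b

/-- σ-additive states: `aₙ ↗ a` implies `s a = lim s aₙ`. -/
structure IsSigmaAdditiveState (s : M → ℝ) : Prop extends IsState s where
  tendsto : ∀ (a : ℕ → M) (b : M), Monotone a → IsLUB (Set.range a) b →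
    Filter.Tendsto (fun n => s (a n)) Filter.atTop (nhds (s b))

end

/-- `M` is σ-complete: every sequence has a supremum and an infimum. -/
def IsSigmaComplete (M : Type*) [MVAlgebra M] : Prop :=
  ∀ a : ℕ → M, (∃ b, IsLUB (Set.range a) b) ∧ ∃ b, IsGLB (Set.range a) b

/-- σ-MV-homomorphisms: MV-homomorphisms that preserve (existing) countable suprema. -/
structure IsSigmaHom {M N : Type*} [MVAlgebra M] [MVAlgebra N] (h : M → N) : Prop where
  map_zero : h zero = zero
  map_neg : ∀ x, h (neg x) = neg (h x)
  map_oplus : ∀ x y, h (oplus x y) = oplus (h x) (h y)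
  map_sup : ∀ (a : ℕ → M) (b : M), IsLUB (Set.range a) b →
    IsLUB (Set.range fun n => h (a n)) (h b)

/-- The standard MV-algebra `[0,1]`: `x ⊕ y = min (x + y) 1`, `x* = 1 - x`. -/
noncomputable instance : MVAlgebra I where
  oplus x y := ⟨min ((x : ℝ) + y) 1, le_min (add_nonneg x.2.1 y.2.1) zero_le_one, min_le_right _ _⟩
  neg := unitInterval.symm
  zero := 0
  oplus_assoc x y z := by
    have := x.2.1; have := z.2.1
    ext; simp only
    grind
  oplus_comm x y := by ext; simp only [add_comm]
  oplus_zero x := by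
    ext; simpa using x.2.2
  neg_neg := unitInterval.symm_symm
  oplus_one x := by
    ext; simpa using x.2.1
  luk x y := by
    obtain ⟨x, hx0, hx1⟩ := x
    obtain ⟨y, hy0, hy1⟩ := y
    ext; simp only [unitInterval.coe_symm_eq]
    grind
  le_iff x y := by
    rw [← Subtype.coe_le_coe, Subtype.ext_iff]
    simp only [unitInterval.coe_symm_eq, Set.Icc.coe_zero]
    grind

/-- `[0,1]^X` with the pointwise operations and order. -/
noncomputable instance (X : Type*) : MVAlgebra (X → I) where
  oplus f g := fun x => oplus (f x) (g x)
  neg f := fun x => neg (f x)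
  zero := fun _ => zero
  oplus_assoc _ _ _ := funext fun _ => oplus_assoc _ _ _
  oplus_comm _ _ := funext fun _ => oplus_comm _ _
  oplus_zero _ := funext fun _ => oplus_zero _
  neg_neg _ := funext fun _ => neg_neg _
  oplus_one _ := funext fun _ => oplus_one _
  luk _ _ := funext fun _ => luk _ _
  le_iff f g := by
    rw [Pi.le_def, funext_iff]
    exact forall_congr' fun x => le_iff (f x) (g x)

end MVAlgebra

/-- `min (∑ₙ aₙ) 1`, the (possibly infinite) sum being taken in `[0,∞]`. -/
noncomputable def truncSum (a : ℕ → I) : I :=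
  ⟨(min (∑' n, ENNReal.ofReal (a n)) 1).toReal, ENNReal.toReal_nonneg,
    ENNReal.toReal_le_of_le_ofReal zero_le_one (by simp)⟩

/-- Tribes of `[0,1]`-valued functions on `X`. -/
structure Tribe (X : Type*) where
  carrier : Set (X → I)
  one_mem : (fun _ => 1) ∈ carrier
  symm_mem : ∀ f ∈ carrier, (fun x => unitInterval.symm (f x)) ∈ carrier
  truncSum_mem : ∀ f : ℕ → X → I, (∀ n, f n ∈ carrier) →
    (fun x => truncSum fun n => f n x) ∈ carrier

namespace Tribe

variable {X : Type*} (T : Tribe X)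

theorem zero_mem : (MVAlgebra.zero : X → I) ∈ T.carrier := by
  have h := T.symm_mem _ T.one_mem
  simp only [unitInterval.symm_one] at h
  exact h

theorem oplus_mem {f g : X → I} (hf : f ∈ T.carrier) (hg : g ∈ T.carrier) :
    MVAlgebra.oplus f g ∈ T.carrier := by
  have h := T.truncSum_mem
    (fun n => if n = 0 then f else if n = 1 then g else MVAlgebra.zero) (by
      intro n
      split_ifs
      · exact hf
      · exact hg
      · exact T.zero_mem)
  convert h using 1
  funext x
  apply Subtype.ext
  have hs : (∑' n : ℕ, ENNReal.ofReal (((if n = 0 then f else if n = 1 then g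
      else MVAlgebra.zero : X → I) x : I) : ℝ)) = ENNReal.ofReal ((f x : ℝ) + g x) := by
    rw [tsum_eq_sum (s := Finset.range 2)]
    · rw [Finset.sum_range_succ, Finset.sum_range_one, ENNReal.ofReal_add (f x).2.1 (g x).2.1]
      simp
    · intro n hn
      have h0 : n ≠ 0 := by rintro rfl; simp at hn
      have h1 : n ≠ 1 := by rintro rfl; simp at hn
      rw [if_neg h0, if_neg h1]
      show ENNReal.ofReal ((0 : I) : ℝ) = 0
      simp
  show min ((f x : ℝ) + g x) 1 = (min _ (1 : ENNReal)).toReal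
  rw [hs, ← ENNReal.ofReal_one, ← ENNReal.ofReal_min, ENNReal.toReal_ofReal]
  exact le_min (add_nonneg (f x).2.1 (g x).2.1) zero_le_one

/-- A tribe is an MV-algebra under the pointwise operations and order. -/
noncomputable instance : MVAlgebra T.carrier where
  oplus f g := ⟨MVAlgebra.oplus f.1 g.1, T.oplus_mem f.2 g.2⟩
  neg f := ⟨MVAlgebra.neg f.1, T.symm_mem _ f.2⟩
  zero := ⟨MVAlgebra.zero, T.zero_mem⟩
  oplus_assoc _ _ _ := Subtype.ext (MVAlgebra.oplus_assoc _ _ _)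
  oplus_comm _ _ := Subtype.ext (MVAlgebra.oplus_comm _ _)
  oplus_zero _ := Subtype.ext (MVAlgebra.oplus_zero _)
  neg_neg _ := Subtype.ext (MVAlgebra.neg_neg _)
  oplus_one _ := Subtype.ext (MVAlgebra.oplus_one _)
  luk _ _ := Subtype.ext (MVAlgebra.luk _ _)
  le_iff f g := by
    rw [Subtype.ext_iff]
    exact MVAlgebra.le_iff f.1 g.1

/-- The characteristic function of `A`. -/
noncomputable def chi (A : Set X) : X → I := A.indicator fun _ => 1

/-- `S₀(T) = {A ⊆ X : χ_A ∈ T}`. -/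
def S₀ : Set (Set X) := {A | chi A ∈ T.carrier}

/-- `B₀(T) = {A ⊆ X : χ_A is a central element of T}`. -/
def B₀ : Set (Set X) := {A | ∃ e : T.carrier, e.1 = chi A ∧ MVAlgebra.IsCentral e}

end Tribe

/-!
Homomorphisms `M → [0,1]` are obtained from prime ideals: an MV-chain maps to `[0,1]` by reading
off binary digits. A σ-complete algebra is archimedean, so these homomorphisms separate its points,
and `M` becomes an algebra of continuous functions on the compact space `Spec M`. A countable
supremum in `M` agrees with the pointwise one off a meagre set; by the Baire property, "equal off a
meagre set" is equality on `M`. Hence the functions that agree with an element of `M` off a meagre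
set form a tribe, which maps onto `M`.

Every function of a tribe is a sum `∑ₙ 2⁻ⁿ χ(Aₙ)` of binary digits that lie in the tribe, and a
state is additive on this expansion. Therefore a state on a tribe is determined by its values at
characteristic functions, which form a measure if the state is σ-additive.
-/

local infixl:65 " ⊹ " => MVAlgebra.oplus
local prefix:max "∼" => MVAlgebra.neg

namespace MVAlgebra

/-- The truncated difference `a ⊖ b = (a* ⊕ b)*`, which is left adjoint to addition:
see `sub_le_iff`. -/
def sub {M : Type*} [MVAlgebra M] (a b : M) : M := ∼(∼a ⊹ b)

/-- The Łukasiewicz product `a ⊙ b = (a* ⊕ b*)*`, dual to `⊕`. -/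
def odot {M : Type*} [MVAlgebra M] (a b : M) : M := ∼(∼a ⊹ ∼b)

end MVAlgebra

local infixl:65 " ⊖ " => MVAlgebra.sub
local infixl:70 " ⊙ " => MVAlgebra.odot

namespace MVAlgebra

section Arithmetic

variable {M : Type*} [MVAlgebra M] {a b c d x : M}

instance : Std.Associative (oplus : M → M → M) := ⟨oplus_assoc⟩

instance : Std.Commutative (oplus : M → M → M) := ⟨oplus_comm⟩

theorem neg_one : ∼(one : M) = zero := neg_neg _

theorem zero_oplus (a : M) : zero ⊹ a = a := by rw [oplus_comm, oplus_zero]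

theorem oplus_one' (a : M) : a ⊹ one = one := oplus_one a

theorem le_iff_neg_oplus_eq_one : a ≤ b ↔ ∼a ⊹ b = one := le_iff a b

theorem neg_injective : Function.Injective (neg : M → M) :=
  Function.LeftInverse.injective neg_neg

theorem neg_oplus_self (a : M) : ∼a ⊹ a = one := le_iff_neg_oplus_eq_one.1 le_rfl

theorem neg_sub (a b : M) : ∼(a ⊖ b) = ∼a ⊹ b := neg_neg _

theorem neg_odot (a b : M) : ∼(a ⊙ b) = ∼a ⊹ ∼b := neg_neg _

theorem neg_sub_neg (a b : M) : ∼a ⊖ ∼b = b ⊖ a := by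
  rw [sub, sub, neg_neg, oplus_comm]

theorem odot_comm (a b : M) : a ⊙ b = b ⊙ a := by rw [odot, odot, oplus_comm]

theorem le_one (a : M) : a ≤ one := by rw [le_iff_neg_oplus_eq_one, oplus_one']

instance : OrderBot M where
  bot := zero
  bot_le a := by rw [le_iff, oplus_comm]; exact oplus_one a

theorem zero_le (a : M) : zero ≤ a := bot_le

theorem le_zero : a ≤ zero ↔ a = zero := le_bot_iff

theorem one_ne_zero [Nontrivial M] : (one : M) ≠ zero := by
  intro h
  obtain ⟨a, b, hab⟩ := exists_pair_ne M
  have eq_zero (x : M) : x = zero := le_zero.1 (h ▸ le_one x)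
  exact hab ((eq_zero a).trans (eq_zero b).symm)

theorem le_oplus_right (a b : M) : a ≤ a ⊹ b := by
  rw [le_iff_neg_oplus_eq_one, ← oplus_assoc, neg_oplus_self, oplus_comm, oplus_one']

theorem le_oplus_left (a b : M) : a ≤ b ⊹ a := oplus_comm a b ▸ le_oplus_right a b

theorem neg_le_neg_iff : ∼a ≤ ∼b ↔ b ≤ a := by
  rw [le_iff, le_iff, neg_neg, oplus_comm]

theorem le_neg_comm : a ≤ ∼b ↔ b ≤ ∼a := by rw [← neg_le_neg_iff, neg_neg]

theorem odot_eq_zero : a ⊙ b = zero ↔ a ≤ ∼b := by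
  rw [le_iff_neg_oplus_eq_one, ← neg_odot]
  exact (neg_injective.eq_iff' rfl).symm

theorem oplus_sub_comm (a b : M) : a ⊹ (b ⊖ a) = b ⊹ (a ⊖ b) := by
  have := luk a b
  rwa [oplus_comm a (∼b), oplus_comm b (∼a)] at this

theorem sub_le_iff : a ⊖ b ≤ c ↔ a ≤ b ⊹ c := by
  rw [le_iff, le_iff, neg_sub, oplus_assoc]

theorem sub_eq_zero : a ⊖ b = zero ↔ a ≤ b := by
  rw [← le_zero, sub_le_iff, oplus_zero]

theorem oplus_sub_of_le (h : a ≤ b) : a ⊹ (b ⊖ a) = b := by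
  rw [oplus_sub_comm, sub_eq_zero.2 h, oplus_zero]

theorem oplus_le_oplus_left (h : b ≤ c) (a : M) : a ⊹ b ≤ a ⊹ c := by
  rw [← oplus_sub_of_le h, ← oplus_assoc]
  exact le_oplus_right _ _

theorem oplus_le_oplus (h : a ≤ b) (h' : c ≤ d) : a ⊹ c ≤ b ⊹ d := by
  refine (oplus_le_oplus_left h' a).trans ?_
  rw [oplus_comm a, oplus_comm b]
  exact oplus_le_oplus_left h d

theorem le_oplus_sub (a b : M) : a ≤ b ⊹ (a ⊖ b) := sub_le_iff.1 le_rfl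

theorem sub_le_sub_right (h : a ≤ b) (c : M) : a ⊖ c ≤ b ⊖ c :=
  sub_le_iff.2 (h.trans (le_oplus_sub b c))

theorem sub_le_sub_left (h : a ≤ b) (c : M) : c ⊖ b ≤ c ⊖ a :=
  neg_le_neg_iff.2 (oplus_le_oplus_left h _)

theorem sub_le_self (a b : M) : a ⊖ b ≤ a := sub_le_iff.2 (le_oplus_left a b)

theorem sub_le_neg (a b : M) : a ⊖ b ≤ ∼b := neg_le_neg_iff.2 (le_oplus_left b _)

theorem odot_le_left (a b : M) : a ⊙ b ≤ a := sub_le_self a (∼b)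

theorem odot_le_right (a b : M) : a ⊙ b ≤ b := odot_comm a b ▸ odot_le_left b a

theorem one_odot (a : M) : one ⊙ a = a := by rw [odot, neg_one, zero_oplus, neg_neg]

theorem oplus_sub_le (ha : a ≤ c) (hb : b ≤ c) : a ⊹ (b ⊖ a) ≤ c := by
  rw [← oplus_sub_of_le ha]
  exact oplus_le_oplus_left (sub_le_sub_right hb a) a

theorem oplus_sub_oplus_le (a b c d : M) : (a ⊹ c) ⊖ (b ⊹ d) ≤ (a ⊖ b) ⊹ (c ⊖ d) := by
  rw [sub_le_iff]
  calc a ⊹ c ≤ b ⊹ (a ⊖ b) ⊹ (d ⊹ (c ⊖ d)) := oplus_le_oplus (le_oplus_sub a b) (le_oplus_sub c d)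
    _ = b ⊹ d ⊹ ((a ⊖ b) ⊹ (c ⊖ d)) := by ac_rfl

theorem sub_le_sub_oplus_sub (a b c : M) : a ⊖ c ≤ (a ⊖ b) ⊹ (b ⊖ c) := by
  rw [sub_le_iff]
  calc a ≤ b ⊹ (a ⊖ b) := le_oplus_sub a b
    _ ≤ c ⊹ (b ⊖ c) ⊹ (a ⊖ b) := oplus_le_oplus (le_oplus_sub b c) le_rfl
    _ = c ⊹ ((a ⊖ b) ⊹ (b ⊖ c)) := by ac_rfl

theorem sub_sub_le (a b : M) : a ⊖ (a ⊖ b) ≤ b := by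
  rw [sub_le_iff, oplus_comm]
  exact le_oplus_sub a b

theorem isSum_zero (a : M) : IsSum a zero a :=
  ⟨le_neg_comm.1 (zero_le _), oplus_zero a⟩

theorem isSum_sub_of_le (h : a ≤ b) : IsSum a (b ⊖ a) b :=
  ⟨le_neg_comm.1 (sub_le_neg b a), oplus_sub_of_le h⟩

theorem IsSum.comm (h : IsSum a b c) : IsSum b a c :=
  ⟨le_neg_comm.1 h.1, (oplus_comm b a).trans h.2⟩

theorem IsSum.sub_eq (h : IsSum a b c) : c ⊖ a = b := by
  have hb := oplus_sub_of_le h.1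
  rw [sub, neg_neg] at hb
  rw [← h.2, sub, oplus_comm _ a, oplus_comm a b, hb, neg_neg]

theorem IsSum.right_unique (h : IsSum a b d) (h' : IsSum a c d) : b = c :=
  h.sub_eq.symm.trans h'.sub_eq

theorem IsSum.assoc (h : IsSum a b x) (h' : IsSum x c d) : IsSum a (b ⊹ c) d := by
  obtain ⟨hab, rfl⟩ := h
  obtain ⟨hc, rfl⟩ := h'
  refine ⟨?_, (oplus_assoc a b c).symm⟩
  rw [le_neg_comm] at hab hc ⊢
  rw [← oplus_sub_of_le hab]
  refine oplus_le_oplus_left ?_ b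
  rwa [sub, neg_neg]

theorem IsSum.rotate (h : IsSum a b (∼c)) : IsSum b c (∼a) := by
  have hsub : ∼a ⊖ b = c := by rw [sub, neg_neg, h.2, neg_neg]
  exact hsub ▸ isSum_sub_of_le h.comm.1

theorem sub_sub_of_le (h : a ≤ b) : b ⊖ (b ⊖ a) = a := (isSum_sub_of_le h).comm.sub_eq

theorem le_sub_comm (ha : a ≤ c) (h : b ≤ c ⊖ a) : a ≤ c ⊖ b :=
  (sub_sub_of_le ha).ge.trans (sub_le_sub_left h c)

theorem eq_zero_of_le_sub (hb : b ≤ c) (h : c ≤ c ⊖ b) : b = zero := by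
  rw [← sub_sub_of_le hb, sub_eq_zero]
  exact h

theorem disjoint_iff_forall_le : Disjoint a b ↔ ∀ c, c ≤ a → c ≤ b → c = zero :=
  forall_congr' fun _ => imp_congr_right fun _ => imp_congr_right fun _ => le_bot_iff

theorem disjoint_iff_sub_eq_left : Disjoint a b ↔ a ⊖ b = a := by
  rw [disjoint_iff_forall_le]
  constructor
  · intro h
    refine (sub_le_self a b).antisymm (sub_eq_zero.1 ?_)
    exact h _ (sub_le_self a _) (sub_sub_le a b)
  · intro h c hca hcb
    exact eq_zero_of_le_sub hca (h.ge.trans (sub_le_sub_left hcb a))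

theorem disjoint_sub_sub (a b : M) : Disjoint (a ⊖ b) (b ⊖ a) := by
  rw [disjoint_iff_forall_le]
  intro c hab hba
  have hsum : IsSum a (b ⊖ a) (a ⊹ (b ⊖ a)) := ⟨le_neg_comm.1 (sub_le_neg b a), rfl⟩
  have hsum' : IsSum b (a ⊖ b) (a ⊹ (b ⊖ a)) :=
    ⟨le_neg_comm.1 (sub_le_neg a b), oplus_sub_comm b a⟩
  refine eq_zero_of_le_sub (c := a ⊹ (b ⊖ a)) (hba.trans (le_oplus_left _ _)) (oplus_sub_le ?_ ?_)
  · exact le_sub_comm (le_oplus_right _ _) (hba.trans hsum.sub_eq.ge)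
  · exact le_sub_comm (le_oplus_sub b a) (hab.trans hsum'.sub_eq.ge)

theorem oplus_le_of_disjoint (h : Disjoint a b) (ha : a ≤ c) (hb : b ≤ c) : a ⊹ b ≤ c := by
  rw [← disjoint_iff_sub_eq_left.1 h.symm]
  exact oplus_sub_le ha hb

theorem disjoint_oplus_left (ha : Disjoint a c) (hb : Disjoint b c) : Disjoint (a ⊹ b) c := by
  rw [disjoint_iff_forall_le] at ha hb ⊢
  intro d hd hdc
  exact ha d (sub_eq_zero.1 (hb _ (sub_le_iff.2 hd) ((sub_le_self d a).trans hdc))) hdc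

end Arithmetic

section Idempotent

variable {M : Type*} [MVAlgebra M] {a b c e x : M}

theorem disjoint_neg_of_oplus_self (he : e ⊹ e = e) : Disjoint e (∼e) := by
  rw [disjoint_comm, disjoint_iff_sub_eq_left, sub, neg_neg, he]

theorem neg_oplus_neg_of_oplus_self (he : e ⊹ e = e) : ∼e ⊹ ∼e = ∼e := by
  have hd := (disjoint_neg_of_oplus_self he).symm
  refine le_antisymm ?_ (le_oplus_right _ _)
  rw [← disjoint_iff_sub_eq_left.1 (disjoint_oplus_left hd hd)]
  exact sub_le_neg _ e

theorem odot_eq_left_of_le (he : e ⊹ e = e) (hx : x ≤ e) : x ⊙ e = x :=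
  disjoint_iff_sub_eq_left.1 ((disjoint_neg_of_oplus_self he).mono_left hx)

theorem oplus_odot_of_oplus_self (he : e ⊹ e = e) (a b : M) :
    (a ⊹ b) ⊙ e = a ⊙ e ⊹ b ⊙ e := by
  apply le_antisymm
  · have h := oplus_sub_oplus_le a (∼e) b (∼e)
    rwa [neg_oplus_neg_of_oplus_self he] at h
  · have hle : a ⊙ e ⊹ b ⊙ e ≤ e :=
      (oplus_le_oplus (odot_le_right a e) (odot_le_right b e)).trans he.le
    rw [← odot_eq_left_of_le he hle]
    exact sub_le_sub_right (oplus_le_oplus (odot_le_left a e) (odot_le_left b e)) _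

theorem isSum_odot_odot_neg (he : e ⊹ e = e) (x : M) : IsSum (x ⊙ e) (x ⊙ ∼e) x := by
  have hd := (disjoint_neg_of_oplus_self he).mono (odot_le_right x e) (odot_le_right x (∼e))
  refine ⟨?_, (oplus_le_of_disjoint hd (odot_le_left _ _) (odot_le_left _ _)).antisymm ?_⟩
  · exact (odot_le_right x e).trans (le_neg_comm.1 (odot_le_right x (∼e)))
  · have hle : x ⊖ x ⊙ e ≤ ∼e := sub_sub_le x (∼e)
    rw [← sub_le_iff, ← odot_eq_left_of_le (neg_oplus_neg_of_oplus_self he) hle]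
    exact sub_le_sub_right (sub_le_self _ _) _

theorem isSum_iff_odot (he : e ⊹ e = e) :
    IsSum a b c ↔ IsSum (a ⊙ e) (b ⊙ e) (c ⊙ e) ∧ IsSum (a ⊙ ∼e) (b ⊙ ∼e) (c ⊙ ∼e) := by
  have he' := neg_oplus_neg_of_oplus_self he
  constructor
  · rintro ⟨hab, rfl⟩
    have hle (d : M) : a ⊙ d ≤ ∼(b ⊙ d) :=
      (odot_le_left a d).trans (hab.trans (neg_le_neg_iff.2 (odot_le_left b d)))
    exact ⟨⟨hle e, (oplus_odot_of_oplus_self he a b).symm⟩,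
      ⟨hle _, (oplus_odot_of_oplus_self he' a b).symm⟩⟩
  · rintro ⟨⟨hle, hsum⟩, ⟨hle', hsum'⟩⟩
    have le_neg {d : M} (hd : d ⊹ d = d) (h : a ⊙ d ≤ ∼(b ⊙ d)) : a ⊙ d ≤ ∼b := by
      rw [neg_odot, oplus_comm, ← sub_le_iff] at h
      exact (odot_eq_left_of_le hd (odot_le_right a d)).ge.trans h
    constructor
    · rw [← (isSum_odot_odot_neg he a).2]
      exact oplus_le_of_disjoint ((disjoint_neg_of_oplus_self he).mono (odot_le_right _ _)
        (odot_le_right _ _)) (le_neg he hle) (le_neg he' hle')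
    · rw [← (isSum_odot_odot_neg he (a ⊹ b)).2, ← (isSum_odot_odot_neg he c).2,
        oplus_odot_of_oplus_self he, oplus_odot_of_oplus_self he', hsum, hsum']

theorem isCentral_of_oplus_self (he : e ⊹ e = e) : IsCentral e := by
  have he' := neg_oplus_neg_of_oplus_self he
  have odot_neg {y : M} (hy : y ≤ e) : y ⊙ ∼e = zero := odot_eq_zero.2 (hy.trans (neg_neg e).ge)
  let φ : M ≃ Set.Iic e × Set.Iic (∼e) :=
    { toFun x := (⟨x ⊙ e, odot_le_right x e⟩, ⟨x ⊙ ∼e, odot_le_right x _⟩)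
      invFun y := y.1.1 ⊹ y.2.1
      left_inv x := (isSum_odot_odot_neg he x).2
      right_inv := by
        rintro ⟨⟨y, hy⟩, ⟨z, hz⟩⟩
        refine Prod.ext (Subtype.ext ?_) (Subtype.ext ?_)
        · change (y ⊹ z) ⊙ e = y
          rw [oplus_odot_of_oplus_self he, odot_eq_left_of_le he hy, odot_eq_zero.2 hz, oplus_zero]
        · change (y ⊹ z) ⊙ ∼e = z
          rw [oplus_odot_of_oplus_self he', odot_neg hy, odot_eq_left_of_le he' hz, zero_oplus] }
  refine ⟨φ, ⟨one_odot e, one_odot (∼e)⟩, fun a b c => isSum_iff_odot he, ⟨?_, odot_neg le_rfl⟩,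
    isSum_odot_odot_neg he⟩
  exact odot_eq_left_of_le he le_rfl

end Idempotent

section Hom

/-- MV-homomorphisms. -/
structure IsHom {M N : Type*} [MVAlgebra M] [MVAlgebra N] (h : M → N) : Prop where
  map_zero : h zero = zero
  map_neg : ∀ a, h (∼a) = ∼(h a)
  map_oplus : ∀ a b, h (a ⊹ b) = h a ⊹ h b

variable {M N : Type*} [MVAlgebra M] [MVAlgebra N] {h : M → N} {a b : M}

theorem IsSigmaHom.isHom (hh : IsSigmaHom h) : IsHom h :=
  ⟨hh.map_zero, hh.map_neg, hh.map_oplus⟩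

namespace IsHom

theorem map_one (hh : IsHom h) : h one = one := by
  rw [one, hh.map_neg, hh.map_zero, one]

theorem map_sub (hh : IsHom h) (a b : M) : h (a ⊖ b) = h a ⊖ h b := by
  simp only [sub, hh.map_neg, hh.map_oplus]

theorem map_odot (hh : IsHom h) (a b : M) : h (a ⊙ b) = h a ⊙ h b := by
  simp only [odot, hh.map_neg, hh.map_oplus]

theorem monotone (hh : IsHom h) : Monotone h := by
  intro a b hab
  rw [le_iff_neg_oplus_eq_one, ← hh.map_neg, ← hh.map_oplus, le_iff_neg_oplus_eq_one.1 hab,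
    hh.map_one]

theorem comp {P : Type*} [MVAlgebra P] {g : N → P} (hg : IsHom g) (hh : IsHom h) :
    IsHom (g ∘ h) where
  map_zero := by rw [Function.comp_apply, hh.map_zero, hg.map_zero]
  map_neg a := by simp only [Function.comp_apply, hh.map_neg, hg.map_neg]
  map_oplus a b := by simp only [Function.comp_apply, hh.map_oplus, hg.map_oplus]

end IsHom

end Hom

section UnitInterval

variable (p q : I)

theorem coe_zero : ((zero : I) : ℝ) = 0 := rfl

theorem coe_one : ((one : I) : ℝ) = 1 := unitInterval.coe_symm_eq 0 |>.trans (sub_zero 1)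

theorem coe_oplus : ((p ⊹ q : I) : ℝ) = min ((p : ℝ) + q) 1 := rfl

theorem coe_neg : ((∼p : I) : ℝ) = 1 - p := rfl

theorem coe_sub : ((p ⊖ q : I) : ℝ) = max ((p : ℝ) - q) 0 := by
  rw [sub, coe_neg, coe_oplus, coe_neg]
  grind

theorem coe_odot : ((p ⊙ q : I) : ℝ) = max ((p : ℝ) + q - 1) 0 := by
  rw [odot, coe_neg, coe_oplus, coe_neg, coe_neg]
  grind

end UnitInterval

section Chain

theorem eq_zero_of_forall_abs_le {x C : ℝ} (h : ∀ n : ℕ, |x| ≤ C * (1 / 2) ^ n) : x = 0 := by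
  have hlim : Filter.Tendsto (fun n : ℕ => C * (1 / 2 : ℝ) ^ n) Filter.atTop (nhds (C * 0)) :=
    (tendsto_pow_atTop_nhds_zero_of_lt_one (by norm_num) (by norm_num)).const_mul C
  have := ge_of_tendsto' hlim h
  rwa [mul_zero, abs_nonpos_iff] at this

variable {C : Type*} [MVAlgebra C] {a b c : C}

open Classical in
/-- The first binary digit of an element of an MV-chain; `1/2` is expanded as `0.0111…`. -/
noncomputable def digit (a : C) : Fin 2 := if a ≤ ∼a then 0 else 1

open Classical in
/-- The remainder `2a - digit a` of an element `a` of an MV-chain. -/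
noncomputable def shift (a : C) : C := if a ≤ ∼a then a ⊹ a else a ⊙ a

/-- The real number in `[0,1]` whose binary digits are those of an element of an MV-chain. -/
noncomputable def val (a : C) : ℝ := Real.ofDigits fun n => digit (shift^[n] a)

theorem val_mem_Icc (a : C) : val a ∈ Set.Icc (0 : ℝ) 1 :=
  ⟨Real.ofDigits_nonneg _, Real.ofDigits_le_one _⟩

theorem two_mul_val (a : C) : 2 * val a = (digit a : ℕ) + val (shift a) := by
  have h := Real.ofDigits_eq_sum_add_ofDigits (fun n => digit (shift^[n] a)) 1
  simp only [Finset.sum_range_one, Real.ofDigitsTerm, Function.iterate_succ_apply] at h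
  rw [val, h, val]
  simp only [Function.iterate_zero, id_eq, Nat.cast_ofNat, pow_one, zero_add]
  ring

theorem val_oplus_self (h : a ≤ ∼a) : val (a ⊹ a) = 2 * val a := by
  rw [two_mul_val, digit, shift, if_pos h, if_pos h, Fin.val_zero, Nat.cast_zero, zero_add]

theorem val_odot_self (h : ¬a ≤ ∼a) : val (a ⊙ a) = 2 * val a - 1 := by
  rw [two_mul_val, digit, shift, if_neg h, if_neg h, Fin.val_one, Nat.cast_one, add_sub_cancel_left]

theorem val_zero : val (zero : C) = 0 := by
  have h := val_oplus_self (zero_le (∼(zero : C)))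
  rw [oplus_zero] at h
  linarith

theorem val_one [Nontrivial C] : val (one : C) = 1 := by
  have hne : ¬(one : C) ≤ ∼one := by
    rw [neg_one, le_zero]
    exact one_ne_zero
  have h := val_odot_self hne
  rw [one_odot] at h
  linarith

theorem IsSum.double (h : IsSum a b (∼c)) (hc : ∼c ≤ c) :
    IsSum (a ⊹ a) (b ⊹ b) (∼(c ⊙ c)) := by
  have hab : IsSum a (b ⊹ b ⊹ a) (∼(c ⊙ c)) := by
    have := h.assoc ⟨hc.trans (neg_neg c).ge, rfl⟩
    rwa [← h.2, show b ⊹ (a ⊹ b) = b ⊹ b ⊹ a by ac_rfl, h.2, ← neg_odot] at this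
  have hba : IsSum (b ⊹ b) a (b ⊹ b ⊹ a) :=
    ⟨(le_oplus_right _ a).trans (le_neg_comm.1 hab.1), rfl⟩
  exact (hba.assoc hab.comm).comm

variable [@Std.Total C (· ≤ ·)]

theorem IsSum.neg_double (h : IsSum a b (∼c)) (ha : a ≤ ∼a) (hb : b ≤ ∼b) (hc : c ≤ ∼c) :
    IsSum (∼(a ⊹ a)) (∼(b ⊹ b)) (∼(∼(c ⊹ c))) := by
  wlog hba : b ≤ a generalizing a b
  · exact (this h.comm hb ha ((total_of (· ≤ ·) b a).resolve_left hba)).comm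
  have isSum_neg_double {x : C} (hx : x ≤ ∼x) : IsSum x (∼(x ⊹ x)) (∼x) := by
    have := isSum_sub_of_le hx
    rwa [sub, neg_neg] at this
  have hdiff : IsSum b (a ⊖ b) a := isSum_sub_of_le hba
  have hc_eq : c = (a ⊖ b) ⊹ ∼(a ⊹ a) :=
    h.rotate.right_unique (hdiff.assoc (isSum_neg_double ha))
  have hb_eq : ∼(b ⊹ b) = (a ⊖ b) ⊹ c :=
    (isSum_neg_double hb).right_unique (hdiff.assoc h.rotate.rotate.comm)
  constructor
  · rw [le_iff_neg_oplus_eq_one, neg_neg, neg_neg]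
    calc a ⊹ a ⊹ (b ⊹ b) = a ⊹ b ⊹ (a ⊹ b) := by ac_rfl
      _ = one := by rw [h.2, ← neg_neg (∼c ⊹ ∼c), ← odot, odot_eq_zero.2 hc, one]
  · rw [neg_neg, hb_eq]
    nth_rewrite 3 [hc_eq]
    ac_rfl

variable [Nontrivial C]

theorem abs_val_add_val_neg_sub_one_le (n : ℕ) (a : C) :
    |val a + val (∼a) - 1| ≤ 1 * (1 / 2) ^ n := by
  induction n generalizing a with
  | zero =>
    have h := val_mem_Icc a
    have h' := val_mem_Icc (∼a)
    rw [pow_zero, mul_one, abs_le]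
    constructor <;> linarith [h.1, h.2, h'.1, h'.2]
  | succ n ih =>
    wlog ha : a ≤ ∼a generalizing a
    · have h := this (∼a) ((neg_neg a).symm ▸ (total_of (· ≤ ·) a (∼a)).resolve_left ha)
      rwa [neg_neg, add_comm (val (∼a))] at h
    have hval := val_oplus_self ha
    by_cases ha' : ∼a ≤ ∼(∼a)
    · have heq : ∼a = a := le_antisymm (ha'.trans (neg_neg a).le) ha
      have hone : a ⊹ a = one := by rw [← neg_oplus_self a, heq]
      rw [hone, val_one] at hval
      rw [heq, show val a + val a - 1 = 0 by linarith, abs_zero]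
      positivity
    · have hval' := val_odot_self ha'
      have hneg : ∼a ⊙ ∼a = ∼(a ⊹ a) := by rw [odot, neg_neg]
      have h := ih (a ⊹ a)
      rw [← hneg, hval, hval', abs_le] at h
      rw [abs_le, pow_succ]
      constructor <;> linarith

theorem val_neg (a : C) : val (∼a) = 1 - val a := by
  linarith [eq_zero_of_forall_abs_le fun n => abs_val_add_val_neg_sub_one_le n a]

theorem abs_val_add_val_add_val_sub_one_le (n : ℕ) (h : IsSum a b (∼c)) :
    |val a + val b + val c - 1| ≤ 2 * (1 / 2) ^ n := by
  induction n generalizing a b c with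
  | zero =>
    have ha := val_mem_Icc a
    have hb := val_mem_Icc b
    have hc := val_mem_Icc c
    rw [pow_zero, mul_one, abs_le]
    constructor <;> linarith [ha.1, ha.2, hb.1, hb.2, hc.1, hc.2]
  | succ n ih =>
    have of_large {a b c : C} (h : IsSum a b (∼c)) (hc : ¬c ≤ ∼c) :
        |val a + val b + val c - 1| ≤ 2 * (1 / 2) ^ (n + 1) := by
      have hc' : ∼c ≤ c := (total_of (· ≤ ·) c (∼c)).resolve_left hc
      have le_neg_self {x : C} (hx : x ≤ ∼c) : x ≤ ∼x := hx.trans (hc'.trans (le_neg_comm.1 hx))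
      have hsum := ih (h.double hc')
      rw [val_oplus_self (le_neg_self (h.2 ▸ le_oplus_right a b)),
        val_oplus_self (le_neg_self (h.2 ▸ le_oplus_left b a)), val_odot_self hc, abs_le] at hsum
      rw [abs_le, pow_succ]
      constructor <;> linarith
    by_cases ha : a ≤ ∼a
    · by_cases hb : b ≤ ∼b
      · by_cases hc : c ≤ ∼c
        · have hsum := ih (h.neg_double ha hb hc)
          rw [val_neg, val_neg, val_neg, val_oplus_self ha, val_oplus_self hb, val_oplus_self hc,
            abs_le] at hsum
          rw [abs_le, pow_succ]
          constructor <;> linarith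
        · exact of_large h hc
      · rw [add_rotate, add_rotate]
        exact of_large h.rotate.rotate hb
    · rw [add_rotate]
      exact of_large h.rotate ha

theorem IsSum.val_add_val (h : IsSum a b c) : val a + val b = val c := by
  rw [← neg_neg c] at h
  have h0 := eq_zero_of_forall_abs_le fun n => abs_val_add_val_add_val_sub_one_le n h
  rw [val_neg] at h0
  linarith

theorem val_oplus (a b : C) : val (a ⊹ b) = min (val a + val b) 1 := by
  rcases total_of (· ≤ ·) a (∼b) with hab | hab
  · rw [IsSum.val_add_val ⟨hab, rfl⟩, min_eq_left (val_mem_Icc _).2]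
  · have hone : a ⊹ b = one := by
      rw [oplus_comm, ← neg_neg b, le_iff_neg_oplus_eq_one.1 hab]
    have hsum := (isSum_sub_of_le hab).val_add_val
    rw [val_neg] at hsum
    rw [hone, val_one, min_eq_right (by linarith [(val_mem_Icc (a ⊖ ∼b)).1])]

theorem isHom_val : IsHom fun a : C => (⟨val a, val_mem_Icc a⟩ : I) where
  map_zero := Subtype.ext val_zero
  map_neg a := Subtype.ext (val_neg a)
  map_oplus a b := Subtype.ext (val_oplus a b)

end Chain

section PartialSums

/-- The partial sums `a 0 ⊕ ⋯ ⊕ a (n - 1)`. -/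
def psum {M : Type*} [MVAlgebra M] (a : ℕ → M) : ℕ → M
  | 0 => zero
  | n + 1 => psum a n ⊹ a n

variable {M N : Type*} [MVAlgebra M] [MVAlgebra N]

theorem IsHom.map_psum {h : M → N} (hh : IsHom h) (a : ℕ → M) (n : ℕ) :
    h (psum a n) = psum (fun i => h (a i)) n := by
  induction n with
  | zero => exact hh.map_zero
  | succ n ih => rw [psum, hh.map_oplus, ih, psum]

theorem monotone_psum (a : ℕ → M) : Monotone (psum a) :=
  monotone_nat_of_le_succ fun _ => le_oplus_right _ _

theorem coe_psum (a : ℕ → I) (n : ℕ) :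
    ((psum a n : I) : ℝ) = min (∑ i ∈ Finset.range n, (a i : ℝ)) 1 := by
  induction n with
  | zero => simp [psum, coe_zero]
  | succ n ih =>
    have := (a n).2.1
    rw [psum, coe_oplus, ih, Finset.sum_range_succ]
    grind

theorem eq_zero_of_forall_psum_const_le_neg (hM : IsSigmaComplete M) {a : M}
    (ha : ∀ n, psum (fun _ => a) n ≤ ∼a) : a = zero := by
  obtain ⟨b, hb⟩ := (hM (psum fun _ => a)).1
  have hab : a ≤ b := by
    have := hb.1 ⟨1, rfl⟩
    rwa [psum, psum, zero_oplus] at this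
  refine eq_zero_of_le_sub hab (hb.2 ?_)
  rintro _ ⟨n, rfl⟩
  rw [← (IsSum.comm ⟨ha n, rfl⟩).sub_eq]
  exact sub_le_sub_right (hb.1 ⟨n + 1, rfl⟩) a

end PartialSums

section Ideals

variable {M : Type*} [MVAlgebra M]

/-- Ideals of an MV-algebra. -/
structure IsIdeal (J : Set M) : Prop where
  zero_mem : zero ∈ J
  mem_of_le : ∀ {a b : M}, a ≤ b → b ∈ J → a ∈ J
  oplus_mem : ∀ {a b : M}, a ∈ J → b ∈ J → a ⊹ b ∈ J

/-- Prime ideals, that is, the ideals whose quotient is totally ordered. -/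
structure IsPrimeIdeal (J : Set M) : Prop extends IsIdeal J where
  sub_mem_or_sub_mem : ∀ a b : M, a ⊖ b ∈ J ∨ b ⊖ a ∈ J

theorem isIdeal_singleton_zero : IsIdeal ({zero} : Set M) where
  zero_mem := rfl
  mem_of_le h hb := le_zero.1 (h.trans hb.le)
  oplus_mem := by
    rintro _ _ rfl rfl
    exact oplus_zero _

theorem isIdeal_sUnion {S : Set (Set M)} (hS : ∀ J ∈ S, IsIdeal J) (hchain : IsChain (· ⊆ ·) S)
    (hne : S.Nonempty) : IsIdeal (⋃₀ S) where
  zero_mem := hne.imp fun J hJ => ⟨hJ, (hS J hJ).zero_mem⟩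
  mem_of_le := fun h ⟨J, hJ, hb⟩ => ⟨J, hJ, (hS J hJ).mem_of_le h hb⟩
  oplus_mem := by
    rintro a b ⟨J, hJ, ha⟩ ⟨K, hK, hb⟩
    rcases hchain.total hJ hK with h | h
    · exact ⟨K, hK, (hS K hK).oplus_mem (h ha) hb⟩
    · exact ⟨J, hJ, (hS J hJ).oplus_mem ha (h hb)⟩

theorem exists_maximal_isIdeal_notMem {c : M} (hc : c ≠ zero) :
    ∃ J : Set M, Maximal (fun J => IsIdeal J ∧ c ∉ J) J := by
  obtain ⟨J, -, hJ⟩ := zorn_subset_nonempty {J : Set M | IsIdeal J ∧ c ∉ J}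
    (fun S hS hchain hne => ⟨⋃₀ S, ⟨isIdeal_sUnion (fun J hJ => (hS hJ).1) hchain hne,
      fun ⟨J, hJ, hcJ⟩ => (hS hJ).2 hcJ⟩, fun _ => Set.subset_sUnion_of_mem⟩)
    {zero} ⟨isIdeal_singleton_zero, hc⟩
  exact ⟨J, hJ⟩

theorem IsIdeal.disjoint_sub {J : Set M} (hJ : IsIdeal J) (q : M) :
    IsIdeal {z : M | ∃ i ∈ J, Disjoint (z ⊖ i) q} where
  zero_mem := ⟨zero, hJ.zero_mem, disjoint_bot_left.mono_left (sub_le_self _ _)⟩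
  mem_of_le := fun h ⟨i, hi, hd⟩ => ⟨i, hi, hd.mono_left (sub_le_sub_right h i)⟩
  oplus_mem := fun ⟨i, hi, hd⟩ ⟨j, hj, hd'⟩ =>
    ⟨i ⊹ j, hJ.oplus_mem hi hj, (disjoint_oplus_left hd hd').mono_left (oplus_sub_oplus_le _ _ _ _)⟩

theorem exists_disjoint_sub_of_maximal {c p q : M} {J : Set M}
    (hJ : Maximal (fun J => IsIdeal J ∧ c ∉ J) J) (hp : p ∉ J) (hpq : Disjoint p q) :
    ∃ i ∈ J, Disjoint (c ⊖ i) q := by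
  by_contra hno
  refine hp (hJ.le_of_ge ⟨hJ.prop.1.disjoint_sub q, hno⟩ (fun i hi => ⟨i, hi, ?_⟩) ?_)
  · rw [sub_eq_zero.2 le_rfl]
    exact disjoint_bot_left
  · exact ⟨zero, hJ.prop.1.zero_mem, hpq.mono_left (sub_le_self _ _)⟩

theorem isPrimeIdeal_of_maximal {c : M} {J : Set M}
    (hJ : Maximal (fun J => IsIdeal J ∧ c ∉ J) J) : IsPrimeIdeal J := by
  refine ⟨hJ.prop.1, fun a b => ?_⟩
  by_contra! hcon
  have hd := disjoint_sub_sub a b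
  obtain ⟨i, hi, hdi⟩ := exists_disjoint_sub_of_maximal hJ hcon.1 hd
  obtain ⟨j, hj, hdj⟩ := exists_disjoint_sub_of_maximal hJ hcon.2 hdi.symm
  have hsub : c ⊖ (i ⊹ j) = zero := by
    refine disjoint_iff_forall_le.1 hdj _ ?_ ?_
    · exact sub_le_sub_left (le_oplus_left j i) c
    · exact sub_le_sub_left (le_oplus_right i j) c
  exact hJ.prop.2 (hJ.prop.1.mem_of_le (sub_eq_zero.1 hsub) (hJ.prop.1.oplus_mem hi hj))

/-- The congruence of an ideal. -/
def IsIdeal.setoid {J : Set M} (hJ : IsIdeal J) : Setoid M where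
  r a b := a ⊖ b ∈ J ∧ b ⊖ a ∈ J
  iseqv :=
    { refl a := by
        rw [sub_eq_zero.2 le_rfl]
        exact ⟨hJ.zero_mem, hJ.zero_mem⟩
      symm := And.symm
      trans h h' :=
        ⟨hJ.mem_of_le (sub_le_sub_oplus_sub _ _ _) (hJ.oplus_mem h.1 h'.1),
          hJ.mem_of_le (sub_le_sub_oplus_sub _ _ _) (hJ.oplus_mem h'.2 h.2)⟩ }

/-- The quotient of an MV-algebra by an ideal. -/
def IsIdeal.Quot {J : Set M} (hJ : IsIdeal J) : Type _ := Quotient hJ.setoid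

/-- The projection to the quotient by an ideal. -/
def IsIdeal.proj {J : Set M} (hJ : IsIdeal J) (a : M) : hJ.Quot := Quotient.mk hJ.setoid a

instance {J : Set M} (hJ : IsIdeal J) : MVAlgebra hJ.Quot :=
  ofAxioms
    (Quotient.map₂ oplus fun _ _ h _ _ h' =>
      ⟨hJ.mem_of_le (oplus_sub_oplus_le _ _ _ _) (hJ.oplus_mem h.1 h'.1),
        hJ.mem_of_le (oplus_sub_oplus_le _ _ _ _) (hJ.oplus_mem h.2 h'.2)⟩)
    (Quotient.map neg fun a b h => by
      change ∼a ⊖ ∼b ∈ J ∧ ∼b ⊖ ∼a ∈ J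
      rw [neg_sub_neg, neg_sub_neg]
      exact h.symm)
    (hJ.proj zero)
    (by rintro ⟨a⟩ ⟨b⟩ ⟨c⟩; exact congrArg hJ.proj (oplus_assoc a b c))
    (by rintro ⟨a⟩ ⟨b⟩; exact congrArg hJ.proj (oplus_comm a b))
    (by rintro ⟨a⟩; exact congrArg hJ.proj (oplus_zero a))
    (by rintro ⟨a⟩; exact congrArg hJ.proj (neg_neg a))
    (by rintro ⟨a⟩; exact congrArg hJ.proj (oplus_one a))
    (by rintro ⟨a⟩ ⟨b⟩; exact congrArg hJ.proj (luk a b))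

theorem IsIdeal.isHom_proj {J : Set M} (hJ : IsIdeal J) : IsHom hJ.proj :=
  ⟨rfl, fun _ => rfl, fun _ _ => rfl⟩

theorem IsIdeal.proj_eq_zero {J : Set M} (hJ : IsIdeal J) {a : M} :
    hJ.proj a = zero ↔ a ∈ J := by
  change Quotient.mk hJ.setoid a = Quotient.mk hJ.setoid zero ↔ _
  rw [Quotient.eq]
  change a ⊖ zero ∈ J ∧ zero ⊖ a ∈ J ↔ a ∈ J
  rw [sub, oplus_zero, neg_neg, sub_eq_zero.2 (zero_le a), and_iff_left hJ.zero_mem]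

theorem IsIdeal.proj_le_proj {J : Set M} (hJ : IsIdeal J) {a b : M} :
    hJ.proj a ≤ hJ.proj b ↔ a ⊖ b ∈ J := by
  rw [← sub_eq_zero, ← hJ.isHom_proj.map_sub, hJ.proj_eq_zero]

theorem IsPrimeIdeal.total_quot {J : Set M} (hJ : IsPrimeIdeal J) :
    @Std.Total hJ.toIsIdeal.Quot (· ≤ ·) where
  total := by
    rintro ⟨a⟩ ⟨b⟩
    exact (hJ.sub_mem_or_sub_mem a b).imp hJ.proj_le_proj.2 hJ.proj_le_proj.2

theorem exists_isHom_le_of_not_le {a b : M} (h : ¬a ≤ b) :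
    ∃ x : M → I, IsHom x ∧ x b ≤ x a := by
  obtain ⟨J, hJ⟩ := exists_maximal_isIdeal_notMem (mt sub_eq_zero.1 h)
  have hprime := isPrimeIdeal_of_maximal hJ
  have hIdeal := hprime.toIsIdeal
  have := hprime.total_quot
  have : Nontrivial hIdeal.Quot := ⟨_, _, mt hIdeal.proj_eq_zero.1 hJ.prop.2⟩
  have hx := (isHom_val (C := hIdeal.Quot)).comp hIdeal.isHom_proj
  refine ⟨_, hx, isHom_val.monotone (hIdeal.proj_le_proj.2 ?_)⟩
  exact (hprime.sub_mem_or_sub_mem a b).resolve_left hJ.prop.2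

theorem eq_zero_of_forall_isHom (hM : IsSigmaComplete M) {a : M}
    (ha : ∀ x : M → I, IsHom x → x a = zero) : a = zero := by
  refine eq_zero_of_forall_psum_const_le_neg hM fun n => ?_
  by_contra hn
  obtain ⟨x, hx, hxa⟩ := exists_isHom_le_of_not_le hn
  rw [hx.map_neg, hx.map_psum, ha x hx, ← Subtype.coe_le_coe, coe_psum, coe_neg, coe_zero] at hxa
  norm_num at hxa

end Ideals

section Infima

variable {M : Type*} [MVAlgebra M]

theorem isGLB_sub_of_isLUB {a : ℕ → M} {b : M} (hb : IsLUB (Set.range a) b) :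
    IsGLB (Set.range fun n => b ⊖ a n) zero := by
  refine ⟨fun _ _ => zero_le _, fun c hc => le_zero.2 ?_⟩
  have hcb : c ≤ b := (hc ⟨0, rfl⟩).trans (sub_le_self _ _)
  refine eq_zero_of_le_sub hcb (hb.2 ?_)
  rintro _ ⟨n, rfl⟩
  exact le_sub_comm (hb.1 ⟨n, rfl⟩) (hc ⟨n, rfl⟩)

theorem psum_congr {a b : ℕ → M} {n : ℕ} (h : ∀ i < n, a i = b i) : psum a n = psum b n := by
  induction n with
  | zero => rfl
  | succ n ih => rw [psum, psum, ih fun i hi => h i (hi.trans n.lt_succ_self), h n n.lt_succ_self]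

theorem eq_zero_of_forall_le_psum {d : ℕ → M} (hd : IsGLB (Set.range d) zero) {c : M} (k : ℕ)
    (hc : ∀ m : ℕ → ℕ, c ≤ psum (fun i => d (m i)) k) : c = zero := by
  induction k with
  | zero => exact le_zero.1 (hc id)
  | succ k ih =>
    refine ih fun m => sub_eq_zero.1 (le_zero.1 (hd.2 ?_))
    rintro _ ⟨j, rfl⟩
    have hsum : psum (fun i => d (Function.update m k j i)) k = psum (fun i => d (m i)) k :=
      psum_congr fun i hi => by rw [Function.update_of_ne hi.ne]
    have h := hc (Function.update m k j)
    rwa [psum, hsum, Function.update_self, ← sub_le_iff] at h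

end Infima

section Spectrum

variable {M : Type*} [MVAlgebra M]

variable (M) in
/-- The spectrum of an MV-algebra: its homomorphisms to the standard MV-algebra, with the topology
of pointwise convergence. -/
abbrev Spec : Type _ := {x : M → I // IsHom x}

theorem isClosed_setOf_isHom : IsClosed {x : M → I | IsHom x} := by
  have hset : {x : M → I | IsHom x} = {x | x zero = zero} ∩
      ((⋂ a, {x | x (∼a) = ∼(x a)}) ∩ ⋂ a, ⋂ b, {x | x (a ⊹ b) = x a ⊹ x b}) := by
    ext x
    simp only [Set.mem_inter_iff, Set.mem_iInter]
    exact ⟨fun h => ⟨h.1, h.2, h.3⟩, fun h => ⟨h.1, h.2.1, h.2.2⟩⟩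
  have hneg (a : M) : Continuous fun x : M → I => ∼(x a) :=
    unitInterval.continuous_symm.comp (continuous_apply a)
  have hoplus (a b : M) : Continuous fun x : M → I => x a ⊹ x b :=
    Continuous.subtype_mk (by fun_prop) _
  rw [hset]
  refine (isClosed_eq (continuous_apply _) continuous_const).inter
    ((isClosed_iInter fun a => ?_).inter (isClosed_iInter fun a => isClosed_iInter fun b => ?_))
  · exact isClosed_eq (continuous_apply _) (hneg a)
  · exact isClosed_eq (continuous_apply _) (hoplus a b)

instance : CompactSpace (Spec M) :=
  isCompact_iff_compactSpace.1 isClosed_setOf_isHom.isCompact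

theorem continuous_eval (a : M) : Continuous fun x : Spec M => (x.1 a : ℝ) :=
  continuous_subtype_val.comp ((continuous_apply a).comp continuous_subtype_val)

theorem le_iff_forall_spec (hM : IsSigmaComplete M) {a b : M} :
    a ≤ b ↔ ∀ x : Spec M, x.1 a ≤ x.1 b := by
  refine ⟨fun h x => x.2.monotone h, fun h => sub_eq_zero.1 ?_⟩
  refine eq_zero_of_forall_isHom hM fun x hx => ?_
  rw [hx.map_sub, sub_eq_zero]
  exact h ⟨x, hx⟩

theorem exists_lt_half_lt_of_pow_le (x y : Spec M) (n : ℕ) {a : M}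
    (h : (1 / 2 : ℝ) ^ n ≤ x.1 a - y.1 a) : ∃ c, (y.1 c : ℝ) < 1 / 2 ∧ 1 / 2 < (x.1 c : ℝ) := by
  induction n generalizing a with
  | zero => exact ⟨a, by linarith [(x.1 a).2.2], by linarith [(y.1 a).2.1]⟩
  | succ n ih =>
    rw [pow_succ] at h
    have hpos : (0 : ℝ) < (1 / 2) ^ n := by positivity
    rcases le_or_gt (x.1 a : ℝ) (1 / 2) with hx | hx
    · refine ih (a := a ⊹ a) ?_
      rw [x.2.map_oplus, y.2.map_oplus, coe_oplus, coe_oplus, min_eq_left (by linarith),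
        min_eq_left (by linarith)]
      linarith
    · rcases lt_or_ge (y.1 a : ℝ) (1 / 2) with hy | hy
      · exact ⟨a, hy, hx⟩
      · refine ih (a := a ⊙ a) ?_
        rw [x.2.map_odot, y.2.map_odot, coe_odot, coe_odot, max_eq_left (by linarith),
          max_eq_left (by linarith)]
        linarith

theorem exists_lt_half_lt_of_ne {x y : Spec M} (h : x ≠ y) :
    ∃ c, (y.1 c : ℝ) < 1 / 2 ∧ 1 / 2 < (x.1 c : ℝ) := by
  obtain ⟨a, ha⟩ := Function.ne_iff.1 (Subtype.coe_ne_coe.2 h)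
  have of_lt {a : M} (ha : (y.1 a : ℝ) < x.1 a) :
      ∃ c, (y.1 c : ℝ) < 1 / 2 ∧ 1 / 2 < (x.1 c : ℝ) := by
    obtain ⟨n, hn⟩ := exists_pow_lt_of_lt_one (sub_pos.2 ha) (show (1 / 2 : ℝ) < 1 by norm_num)
    exact exists_lt_half_lt_of_pow_le x y n hn.le
  rcases ha.lt_or_gt with hlt | hlt
  · refine of_lt (a := ∼a) ?_
    rw [x.2.map_neg, y.2.map_neg, coe_neg, coe_neg]
    exact sub_lt_sub_left (Subtype.coe_lt_coe.2 hlt) 1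
  · exact of_lt hlt

theorem exists_pos_eq_zero_off {U : Set (Spec M)} (hU : IsOpen U) {x : Spec M} (hx : x ∈ U) :
    ∃ c : M, 0 < (x.1 c : ℝ) ∧ ∀ y ∉ U, (y.1 c : ℝ) = 0 := by
  refine hU.isClosed_compl.isCompact.induction_on
    (p := fun S => ∃ c : M, 0 < (x.1 c : ℝ) ∧ ∀ y ∈ S, (y.1 c : ℝ) = 0) ?_ ?_ ?_ ?_
  · exact ⟨one, by rw [x.2.map_one, coe_one]; exact one_pos, by simp⟩
  · rintro S S' hS ⟨c, hxc, hc⟩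
    exact ⟨c, hxc, fun y hy => hc y (hS hy)⟩
  · rintro S S' ⟨c, hxc, hc⟩ ⟨d, hxd, hd⟩
    have coe_inf (z : Spec M) : (z.1 (c ⊖ (c ⊖ d)) : ℝ) = min (z.1 c : ℝ) (z.1 d) := by
      rw [z.2.map_sub, z.2.map_sub, coe_sub, coe_sub]
      have := (z.1 c).2.1
      have := (z.1 d).2.1
      grind
    refine ⟨c ⊖ (c ⊖ d), coe_inf x ▸ lt_min hxc hxd, ?_⟩
    rintro y (hy | hy)
    · rw [coe_inf, hc y hy, min_eq_left (y.1 d).2.1]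
    · rw [coe_inf, hd y hy, min_eq_right (y.1 c).2.1]
  · intro y hy
    obtain ⟨c, hyc, hxc⟩ := exists_lt_half_lt_of_ne (ne_of_mem_of_not_mem hx hy)
    refine ⟨{z : Spec M | (z.1 c : ℝ) < 1 / 2}, mem_nhdsWithin_of_mem_nhds
      ((isOpen_lt (continuous_eval c) continuous_const).mem_nhds hyc), c ⊙ c, ?_, ?_⟩
    · rw [x.2.map_odot, coe_odot]
      exact lt_max_of_lt_left (by linarith)
    · intro z (hz : (z.1 c : ℝ) < 1 / 2)
      rw [z.2.map_odot, coe_odot]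
      exact max_eq_right (by linarith)

theorem dense_setOf_exists_sub_lt (hM : IsSigmaComplete M) {a : ℕ → M} {b : M}
    (hb : IsLUB (Set.range a) b) {δ : ℝ} (hδ : 0 < δ) :
    Dense {x : Spec M | ∃ n, (x.1 b : ℝ) - x.1 (a n) < δ} := by
  rw [dense_iff_inter_open]
  rintro U hU ⟨x, hx⟩
  by_contra hempty
  have hle (y : Spec M) (hy : y ∈ U) (n : ℕ) : δ ≤ y.1 b - y.1 (a n) := by
    by_contra hlt
    exact hempty ⟨y, hy, n, not_le.1 hlt⟩
  obtain ⟨c, hxc, hc⟩ := exists_pos_eq_zero_off hU hx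
  obtain ⟨k, hk⟩ := exists_nat_ge (1 / δ)
  rw [div_le_iff₀ hδ] at hk
  suffices h : c = zero by
    rw [h, x.2.map_zero, coe_zero] at hxc
    exact hxc.false
  refine eq_zero_of_forall_le_psum (isGLB_sub_of_isLUB hb) k fun m => ?_
  rw [le_iff_forall_spec hM]
  intro y
  rw [y.2.map_psum, ← Subtype.coe_le_coe, coe_psum]
  by_cases hy : y ∈ U
  · refine (y.1 c).2.2.trans (le_min (hk.trans ?_) le_rfl)
    calc k * δ = ∑ _i ∈ Finset.range k, δ := by
          rw [Finset.sum_const, Finset.card_range, nsmul_eq_mul]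
      _ ≤ ∑ i ∈ Finset.range k, (y.1 (b ⊖ a (m i)) : ℝ) := by
          refine Finset.sum_le_sum fun i _ => ?_
          rw [y.2.map_sub, coe_sub]
          exact le_max_of_le_left (hle y hy (m i))
  · rw [hc y hy]
    exact le_min (Finset.sum_nonneg fun i _ => (y.1 _).2.1) zero_le_one

theorem eventually_residual_isLUB (hM : IsSigmaComplete M) {a : ℕ → M} {b : M}
    (hb : IsLUB (Set.range a) b) :
    ∀ᶠ x : Spec M in residual (Spec M), IsLUB (Set.range fun n => x.1 (a n)) (x.1 b) := by
  have hclose (k : ℕ) : ∀ᶠ x : Spec M in residual (Spec M),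
      ∃ n, (x.1 b : ℝ) - x.1 (a n) < 1 / ((k : ℝ) + 1) := by
    refine residual_of_dense_open ?_ (dense_setOf_exists_sub_lt hM hb (by positivity))
    simp only [Set.ofPred_exists]
    exact isOpen_iUnion fun n =>
      isOpen_lt ((continuous_eval b).sub (continuous_eval (a n))) continuous_const
  filter_upwards [eventually_countable_forall.2 hclose] with x hx
  constructor
  · rintro _ ⟨n, rfl⟩
    exact x.2.monotone (hb.1 ⟨n, rfl⟩)
  · intro u hu
    refine Subtype.coe_le_coe.1 (le_of_forall_pos_lt_add fun ε hε => ?_)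
    obtain ⟨k, hk⟩ := exists_nat_one_div_lt hε
    obtain ⟨n, hn⟩ := hx k
    have hun : (x.1 (a n) : ℝ) ≤ u := hu ⟨n, rfl⟩
    linarith

theorem eq_of_eventually_residual_eq (hM : IsSigmaComplete M) {a b : M}
    (h : ∀ᶠ x : Spec M in residual (Spec M), x.1 a = x.1 b) : a = b := by
  have heval : (fun x : Spec M => (x.1 a : ℝ)) = fun x : Spec M => (x.1 b : ℝ) :=
    Continuous.ext_on (dense_of_mem_residual h) (continuous_eval a) (continuous_eval b)
      fun x hx => congrArg Subtype.val hx
  have hspec (x : Spec M) : x.1 a = x.1 b := Subtype.ext (congrFun heval x)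
  exact le_antisymm ((le_iff_forall_spec hM).2 fun x => (hspec x).le)
    ((le_iff_forall_spec hM).2 fun x => (hspec x).ge)

end Spectrum

section LoomisSikorski

theorem ofReal_truncSum (p : ℕ → I) :
    ENNReal.ofReal (truncSum p) = min (∑' n, ENNReal.ofReal (p n)) 1 :=
  ENNReal.ofReal_toReal (min_lt_of_right_lt ENNReal.one_lt_top).ne

theorem isLUB_truncSum (p : ℕ → I) : IsLUB (Set.range (psum p)) (truncSum p) := by
  have hpsum (n : ℕ) : ENNReal.ofReal (psum p n : I) =
      min (∑ i ∈ Finset.range n, ENNReal.ofReal (p i)) 1 := by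
    rw [coe_psum, ENNReal.ofReal_min, ENNReal.ofReal_one,
      ENNReal.ofReal_sum_of_nonneg fun i _ => (p i).2.1]
  have hsup : ENNReal.ofReal (truncSum p) = ⨆ n, ENNReal.ofReal (psum p n : I) := by
    simp only [ofReal_truncSum, hpsum, ENNReal.tsum_eq_iSup_nat]
    exact iSup_inf_eq _ _
  rw [isLUB_iff_le_iff]
  intro u
  rw [← Subtype.coe_le_coe, ← ENNReal.ofReal_le_ofReal_iff u.2.1, hsup, iSup_le_iff,
    mem_upperBounds, Set.forall_mem_range]
  exact forall_congr' fun n => ENNReal.ofReal_le_ofReal_iff u.2.1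

variable {M : Type*} [MVAlgebra M]

/-- The Loomis–Sikorski tribe of a σ-complete MV-algebra: the functions on the spectrum that agree
with an element of the algebra off a meagre set. -/
def loomisSikorskiTribe (hM : IsSigmaComplete M) : Tribe (Spec M) where
  carrier := {f | ∃ a : M, ∀ᶠ x : Spec M in residual (Spec M), f x = x.1 a}
  one_mem := ⟨one, Filter.Eventually.of_forall fun x => by
    rw [x.2.map_one]
    exact Subtype.ext coe_one.symm⟩
  symm_mem := by
    rintro f ⟨a, ha⟩
    refine ⟨∼a, ?_⟩
    filter_upwards [ha] with x hx
    rw [hx, x.2.map_neg]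
    rfl
  truncSum_mem := by
    intro f hf
    choose a ha using hf
    obtain ⟨b, hb⟩ := (hM (psum a)).1
    refine ⟨b, ?_⟩
    filter_upwards [eventually_countable_forall.2 ha, eventually_residual_isLUB hM hb] with x hx hxb
    simp only [hx]
    refine (isLUB_truncSum _).unique ?_
    simpa only [x.2.map_psum] using hxb

/-- The Loomis–Sikorski homomorphism: the element of the algebra with which a function of the tribe
agrees off a meagre set. -/
noncomputable def loomisSikorskiHom (hM : IsSigmaComplete M)
    (f : (loomisSikorskiTribe hM).carrier) : M :=
  f.2.choose

theorem eventually_eq_loomisSikorskiHom (hM : IsSigmaComplete M)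
    (f : (loomisSikorskiTribe hM).carrier) :
    ∀ᶠ x : Spec M in residual (Spec M), f.1 x = x.1 (loomisSikorskiHom hM f) :=
  f.2.choose_spec

theorem loomisSikorskiHom_eq (hM : IsSigmaComplete M) {f : (loomisSikorskiTribe hM).carrier} {a : M}
    (h : ∀ᶠ x : Spec M in residual (Spec M), f.1 x = x.1 a) : loomisSikorskiHom hM f = a := by
  refine eq_of_eventually_residual_eq hM ?_
  filter_upwards [h, eventually_eq_loomisSikorskiHom hM f] with x hfa hf
  rw [← hfa, ← hf]

theorem loomisSikorskiHom_surjective (hM : IsSigmaComplete M) :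
    Function.Surjective (loomisSikorskiHom hM) := fun a =>
  ⟨⟨fun x => x.1 a, a, Filter.Eventually.of_forall fun _ => rfl⟩,
    loomisSikorskiHom_eq hM (Filter.Eventually.of_forall fun _ => rfl)⟩

theorem isSigmaHom_loomisSikorskiHom (hM : IsSigmaComplete M) :
    IsSigmaHom (loomisSikorskiHom hM) where
  map_zero := loomisSikorskiHom_eq hM (Filter.Eventually.of_forall fun x => x.2.map_zero.symm)
  map_neg f := by
    refine loomisSikorskiHom_eq hM ?_
    filter_upwards [eventually_eq_loomisSikorskiHom hM f] with x hf
    rw [x.2.map_neg, ← hf]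
    rfl
  map_oplus f g := by
    refine loomisSikorskiHom_eq hM ?_
    filter_upwards [eventually_eq_loomisSikorskiHom hM f,
      eventually_eq_loomisSikorskiHom hM g] with x hf hg
    rw [x.2.map_oplus, ← hf, ← hg]
    rfl
  map_sup f g hg := by
    obtain ⟨b, hb⟩ := (hM fun n => loomisSikorskiHom hM (f n)).1
    have hsup : ∀ᶠ x : Spec M in residual (Spec M), (⨆ n, (f n).1 x) = x.1 b := by
      filter_upwards [eventually_residual_isLUB hM hb, eventually_countable_forall.2 fun n =>
        eventually_eq_loomisSikorskiHom hM (f n)] with x hxb hf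
      simp only [hf]
      exact isLUB_iSup.unique hxb
    have hg_eq : g = ⟨fun x => ⨆ n, (f n).1 x, b, hsup⟩ := by
      refine hg.unique ⟨?_, fun u hu x => iSup_le fun n => hu ⟨n, rfl⟩ x⟩
      rintro _ ⟨n, rfl⟩ x
      exact le_iSup (fun n => (f n).1 x) n
    rw [hg_eq, loomisSikorskiHom_eq hM hsup]
    exact hb

end LoomisSikorski

section States

variable {M N : Type*} [MVAlgebra M] [MVAlgebra N] {s : M → ℝ} {a b : M}

theorem oplus_sub_left (a b : M) : (a ⊹ b) ⊖ a = b ⊖ a ⊙ b := by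
  rw [sub, sub, neg_injective.eq_iff, odot, oplus_comm (∼a), luk, neg_neg, oplus_comm]

namespace IsState

theorem map_zero (hs : IsState s) : s zero = 0 := by
  linarith [hs.map_sum _ _ _ (isSum_zero zero)]

theorem add_eq (hs : IsState s) (a b : M) : s a + s b = s (a ⊹ b) + s (a ⊙ b) := by
  have hoplus := hs.map_sum _ _ _ (isSum_sub_of_le (le_oplus_right a b))
  have hodot := hs.map_sum _ _ _ (isSum_sub_of_le (odot_le_right a b))
  rw [oplus_sub_left] at hoplus
  linarith

theorem map_psum (hs : IsState s) {a : ℕ → M} (ha : ∀ n, psum a n ≤ ∼(a n)) (n : ℕ) :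
    s (psum a n) = ∑ i ∈ Finset.range n, s (a i) := by
  induction n with
  | zero => exact hs.map_zero
  | succ n ih => rw [Finset.sum_range_succ, ← ih, psum, hs.map_sum _ _ _ ⟨ha n, rfl⟩]

theorem nonempty_spec (hs : IsState s) (hM : IsSigmaComplete M) : Nonempty (Spec M) := by
  by_contra hempty
  have one_eq_zero : (one : M) = zero :=
    eq_zero_of_forall_isHom hM fun x hx => (hempty ⟨x, hx⟩).elim
  have := hs.map_one
  rw [one_eq_zero, hs.map_zero] at this
  exact zero_ne_one this

end IsState

namespace IsSigmaAdditiveState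

theorem hasSum (hs : IsSigmaAdditiveState s) {a : ℕ → M} (ha : ∀ n, psum a n ≤ ∼(a n))
    (hb : IsLUB (Set.range (psum a)) b) : HasSum (fun n => s (a n)) (s b) := by
  rw [hasSum_iff_tendsto_nat_of_nonneg fun n => (hs.mem_Icc (a n)).1]
  simpa only [hs.map_psum ha] using hs.tendsto _ _ (monotone_psum a) hb

theorem comp {s : N → ℝ} (hs : IsSigmaAdditiveState s) {h : M → N} (hh : IsSigmaHom h) :
    IsSigmaAdditiveState fun a => s (h a) where
  mem_Icc a := hs.mem_Icc _
  map_one := by rw [hh.isHom.map_one, hs.map_one]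
  map_sum a b c hc := hs.map_sum _ _ _
    ⟨hh.map_neg b ▸ hh.isHom.monotone hc.1, by rw [← hh.map_oplus, hc.2]⟩
  tendsto a b ha hb := hs.tendsto _ _ (hh.isHom.monotone.comp ha) (hh.map_sup a b hb)

end IsSigmaAdditiveState

end States

end MVAlgebra

namespace Tribe

open MVAlgebra

variable {X : Type*} {T : Tribe X}

section Evaluation

theorem isHom_eval (x : X) : IsHom fun f : T.carrier => f.1 x where
  map_zero := rfl
  map_neg _ := rfl
  map_oplus _ _ := rfl

theorem ext_coe {f g : T.carrier} (h : ∀ x, (f.1 x : ℝ) = g.1 x) : f = g :=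
  Subtype.ext (funext fun x => Subtype.ext (h x))

theorem coe_one_apply (x : X) : ((one : T.carrier).1 x : ℝ) = 1 :=
  (congrArg Subtype.val (isHom_eval x).map_one).trans coe_one

theorem coe_oplus_apply (f g : T.carrier) (x : X) :
    ((f ⊹ g).1 x : ℝ) = min ((f.1 x : ℝ) + g.1 x) 1 := rfl

theorem coe_odot_apply (f g : T.carrier) (x : X) :
    ((f ⊙ g).1 x : ℝ) = max ((f.1 x : ℝ) + g.1 x - 1) 0 :=
  (congrArg Subtype.val ((isHom_eval x).map_odot f g)).trans (coe_odot _ _)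

theorem coe_sub_apply (f g : T.carrier) (x : X) :
    ((f ⊖ g).1 x : ℝ) = max ((f.1 x : ℝ) - g.1 x) 0 :=
  (congrArg Subtype.val ((isHom_eval x).map_sub f g)).trans (coe_sub _ _)

theorem psum_apply (f : ℕ → T.carrier) (n : ℕ) (x : X) :
    (psum f n).1 x = psum (fun i => (f i).1 x) n :=
  (isHom_eval x).map_psum f n

theorem coe_add_coe_of_isSum {f g k : T.carrier} (h : IsSum f g k) (x : X) :
    (f.1 x : ℝ) + g.1 x = k.1 x := by
  have hle : (f.1 x : ℝ) ≤ 1 - g.1 x := h.1 x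
  rw [← h.2, coe_oplus_apply, min_eq_left (by linarith)]

theorem isLUB_psum {f : ℕ → T.carrier} {g : T.carrier}
    (h : ∀ x, g.1 x = truncSum fun n => (f n).1 x) : IsLUB (Set.range (psum f)) g := by
  have hlub (x : X) : IsLUB (Set.range fun n => (psum f n).1 x) (g.1 x) := by
    simpa only [psum_apply, h] using isLUB_truncSum fun n => (f n).1 x
  constructor
  · rintro _ ⟨n, rfl⟩ x
    exact (hlub x).1 ⟨n, rfl⟩
  · intro u hu x
    refine (hlub x).2 ?_
    rintro _ ⟨n, rfl⟩
    exact hu ⟨n, rfl⟩ x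

end Evaluation

section TruncSum

theorem le_truncSum (p : ℕ → I) (n : ℕ) : p n ≤ truncSum p :=
  (le_oplus_left (p n) (psum p n)).trans ((isLUB_truncSum p).1 ⟨n + 1, rfl⟩)

theorem truncSum_zero : truncSum (fun _ => 0) = 0 :=
  Subtype.ext (by simp [truncSum])

theorem truncSum_const_of_ne_zero {p : I} (hp : p ≠ 0) : truncSum (fun _ => p) = 1 := by
  have hpos : ENNReal.ofReal p ≠ 0 := by
    simpa using unitInterval.pos_iff_ne_zero.2 hp
  exact Subtype.ext (by simp [truncSum, ENNReal.tsum_const_eq_top_of_ne_zero hpos])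

end TruncSum

section Measurable

theorem chi_of_mem {A : Set X} {x : X} (h : x ∈ A) : chi A x = 1 := Set.indicator_of_mem h _

theorem chi_of_notMem {A : Set X} {x : X} (h : x ∉ A) : chi A x = 0 :=
  Set.indicator_of_notMem h _

theorem chi_iUnion (A : ℕ → Set X) :
    chi (⋃ n, A n) = fun x => truncSum fun n => chi (A n) x := by
  funext x
  by_cases h : ∃ n, x ∈ A n
  · rw [chi_of_mem (Set.mem_iUnion.2 h)]
    obtain ⟨n, hn⟩ := h
    refine le_antisymm ?_ unitInterval.le_one'
    simpa only [chi_of_mem hn] using le_truncSum (fun n => chi (A n) x) n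
  · rw [chi_of_notMem (Set.mem_iUnion.not.2 h)]
    simp only [not_exists] at h
    simp only [chi_of_notMem (h _), truncSum_zero]

theorem chi_compl (A : Set X) : chi Aᶜ = fun x => unitInterval.symm (chi A x) := by
  funext x
  by_cases h : x ∈ A
  · rw [chi_of_mem h, chi_of_notMem (Set.notMem_compl_iff.2 h), unitInterval.symm_one]
  · rw [chi_of_notMem h, chi_of_mem (Set.mem_compl h), unitInterval.symm_zero]

variable (T) in
/-- The σ-algebra `S₀(T)` of the sets whose characteristic function belongs to the tribe. -/
abbrev measurableSpace : MeasurableSpace X where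
  MeasurableSet' A := chi A ∈ T.carrier
  measurableSet_empty := by
    convert T.zero_mem using 1
    exact Set.indicator_empty _
  measurableSet_compl A hA := chi_compl A ▸ T.symm_mem _ hA
  measurableSet_iUnion A hA := chi_iUnion A ▸ T.truncSum_mem _ hA

/-- The characteristic function of a measurable set as an element of the tribe. -/
noncomputable def ind {A : Set X} (hA : MeasurableSet[T.measurableSpace] A) : T.carrier :=
  ⟨chi A, hA⟩

theorem coe_ind_apply {A : Set X} (hA : MeasurableSet[T.measurableSpace] A) (x : X) :
    ((ind hA).1 x : ℝ) = A.indicator 1 x := by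
  change ((chi A x : I) : ℝ) = A.indicator 1 x
  by_cases hx : x ∈ A <;> simp [chi, hx]

variable (T) in
theorem B₀_eq_S₀ : T.B₀ = T.S₀ := by
  ext A
  constructor
  · rintro ⟨e, he, -⟩
    exact (he ▸ e.2 : chi A ∈ T.carrier)
  · intro hA
    refine ⟨⟨chi A, hA⟩, rfl, isCentral_of_oplus_self (ext_coe fun x => ?_)⟩
    rw [coe_oplus_apply]
    by_cases hx : x ∈ A <;> simp [chi, hx]

theorem measurableSet_support (f : T.carrier) :
    MeasurableSet[T.measurableSpace] {x | f.1 x ≠ 0} := by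
  change chi _ ∈ T.carrier
  convert T.truncSum_mem (fun _ => f.1) (fun _ => f.2) using 1
  funext x
  by_cases h : f.1 x = 0
  · rw [chi_of_notMem (not_not.2 h), h, truncSum_zero]
  · rw [chi_of_mem h, truncSum_const_of_ne_zero h]

/-- Splits off the first binary digit of the values of `f`, the digit being `1` where `f > 1/2`. -/
theorem exists_ind_add_eq_two_mul (f : T.carrier) :
    ∃ (A : Set X) (hA : MeasurableSet[T.measurableSpace] A) (g : T.carrier),
      ∀ x, (f.1 x : ℝ) + f.1 x = (ind hA).1 x + g.1 x := by
  have hA := measurableSet_support (f ⊙ f)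
  refine ⟨_, hA, (f ⊹ f) ⊖ ind hA ⊹ f ⊙ f, fun x => ?_⟩
  have hf := (f.1 x).2
  have hmem : x ∈ {x | (f ⊙ f).1 x ≠ 0} ↔ 1 < (f.1 x : ℝ) + f.1 x := by
    rw [Set.mem_ofPred_eq, ← unitInterval.pos_iff_ne_zero, ← unitInterval.coe_pos, coe_odot_apply]
    grind
  rw [coe_oplus_apply, coe_sub_apply, coe_oplus_apply, coe_odot_apply, coe_ind_apply]
  by_cases hx : x ∈ {x | (f ⊙ f).1 x ≠ 0}
  · rw [Set.indicator_of_mem hx, Pi.one_apply]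
    grind
  · rw [Set.indicator_of_notMem hx]
    grind

theorem exists_measurable_abs_sub_le (n : ℕ) (f : T.carrier) :
    ∃ g : X → ℝ, Measurable[T.measurableSpace] g ∧ ∀ x, |g x - f.1 x| ≤ (1 / 2) ^ n := by
  let _ := T.measurableSpace
  induction n generalizing f with
  | zero =>
    refine ⟨0, measurable_zero, fun x => ?_⟩
    rw [Pi.zero_apply, zero_sub, abs_neg, abs_of_nonneg (f.1 x).2.1, pow_zero]
    exact (f.1 x).2.2
  | succ n ih =>
    obtain ⟨A, hA, f', hf'⟩ := exists_ind_add_eq_two_mul f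
    obtain ⟨g, hg, hgf⟩ := ih f'
    refine ⟨fun x => (A.indicator 1 x + g x) / 2,
      ((measurable_one.indicator hA).add hg).div_const 2, fun x => ?_⟩
    have hx := hf' x
    rw [coe_ind_apply] at hx
    rw [show (A.indicator 1 x + g x) / 2 - (f.1 x : ℝ) = (g x - f'.1 x) / 2 by linarith,
      abs_div, abs_two, pow_succ]
    linarith [hgf x]

theorem measurable_coe (f : T.carrier) : Measurable[T.measurableSpace] fun x => (f.1 x : ℝ) := by
  let _ := T.measurableSpace
  choose g hg hgf using fun n => exists_measurable_abs_sub_le n f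
  refine measurable_of_tendsto_metrizable hg (tendsto_pi_nhds.2 fun x => ?_)
  exact tendsto_iff_dist_tendsto_zero.2 (squeeze_zero (fun _ => dist_nonneg) (fun n => hgf n x)
    (tendsto_pow_atTop_nhds_zero_of_lt_one (by norm_num) (by norm_num)))

end Measurable

open MeasureTheory

section States

variable {t t' : T.carrier → ℝ}

theorem add_eq_add_of_isState (ht : IsState t) {f g f' g' : T.carrier}
    (h : ∀ x, (f.1 x : ℝ) + g.1 x = f'.1 x + g'.1 x) : t f + t g = t f' + t g' := by
  have hoplus : f ⊹ g = f' ⊹ g' := ext_coe fun x => by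
    rw [coe_oplus_apply, coe_oplus_apply, h]
  have hodot : f ⊙ g = f' ⊙ g' := ext_coe fun x => by
    rw [coe_odot_apply, coe_odot_apply, h]
  rw [ht.add_eq f g, ht.add_eq f' g', hoplus, hodot]

/-- Splitting off `n` binary digits of `f` replaces `t f - t' f` by a difference of values of the
two states, divided by `2 ^ n`. -/
theorem abs_sub_le_of_eq_ind (ht : IsState t) (ht' : IsState t')
    (h : ∀ A (hA : MeasurableSet[T.measurableSpace] A), t (ind hA) = t' (ind hA)) (n : ℕ)
    (f : T.carrier) : |t f - t' f| ≤ (1 / 2) ^ n := by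
  induction n generalizing f with
  | zero =>
    rw [pow_zero, abs_le]
    constructor <;> linarith [(ht.mem_Icc f).1, (ht.mem_Icc f).2, (ht'.mem_Icc f).1,
      (ht'.mem_Icc f).2]
  | succ n ih =>
    obtain ⟨A, hA, g, hg⟩ := exists_ind_add_eq_two_mul f
    have hsub : t f - t' f = (t g - t' g) / 2 := by
      linarith [add_eq_add_of_isState ht hg, add_eq_add_of_isState ht' hg, h A hA]
    rw [hsub, abs_div, abs_two, pow_succ]
    linarith [ih g]

theorem eq_of_isState_of_eq_ind (ht : IsState t) (ht' : IsState t')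
    (h : ∀ A (hA : MeasurableSet[T.measurableSpace] A), t (ind hA) = t' (ind hA)) : t = t' := by
  funext f
  refine _root_.sub_eq_zero.1 (eq_zero_of_forall_abs_le (C := 1) fun n => ?_)
  rw [one_mul]
  exact abs_sub_le_of_eq_ind ht ht' h n f

theorem psum_ind_le_neg_ind {A : ℕ → Set X} (hA : ∀ n, MeasurableSet[T.measurableSpace] (A n))
    (hd : Pairwise (Function.onFun Disjoint A)) (n : ℕ) :
    psum (fun i => ind (hA i)) n ≤ ∼(ind (hA n)) := by
  intro x
  change ((psum (fun i => ind (hA i)) n).1 x : ℝ) ≤ 1 - (ind (hA n)).1 x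
  rw [psum_apply, coe_psum]
  by_cases hx : x ∈ A n
  · have hzero (i : ℕ) (hi : i ∈ Finset.range n) : ((ind (hA i)).1 x : ℝ) = 0 := by
      rw [coe_ind_apply, Set.indicator_of_notMem]
      exact Set.disjoint_right.1 (hd (Finset.mem_range.1 hi).ne) hx
    rw [Finset.sum_eq_zero hzero, coe_ind_apply, Set.indicator_of_mem hx]
    simp
  · rw [coe_ind_apply, Set.indicator_of_notMem hx, sub_zero]
    exact min_le_right _ _

theorem hasSum_ind (ht : IsSigmaAdditiveState t) {A : ℕ → Set X}
    (hA : ∀ n, MeasurableSet[T.measurableSpace] (A n)) (hd : Pairwise (Function.onFun Disjoint A)) :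
    HasSum (fun n => t (ind (hA n))) (t (ind (.iUnion hA))) :=
  ht.hasSum (psum_ind_le_neg_ind hA hd) (isLUB_psum fun x => congrFun (chi_iUnion A) x)

theorem ind_empty : ind (T := T) (@MeasurableSet.empty X T.measurableSpace) = zero :=
  Subtype.ext (Set.indicator_empty _)

theorem ind_univ : ind (T := T) (@MeasurableSet.univ X T.measurableSpace) = one :=
  ext_coe fun x => by
    rw [coe_ind_apply, Set.indicator_univ, coe_one_apply, Pi.one_apply]

/-- The measure `A ↦ t (χ_A)` of a σ-additive state `t` on a tribe. -/
noncomputable def stateMeasure (ht : IsSigmaAdditiveState t) : Measure[T.measurableSpace] X :=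
  @Measure.ofMeasurable X T.measurableSpace (fun _ hA => ENNReal.ofReal (t (ind hA)))
    (by rw [ind_empty, ht.map_zero, ENNReal.ofReal_zero])
    (fun A hA hd => by
      have hsum := hasSum_ind ht hA hd
      rw [← hsum.tsum_eq,
        ENNReal.ofReal_tsum_of_nonneg (fun n => (ht.mem_Icc _).1) hsum.summable])

theorem stateMeasure_apply (ht : IsSigmaAdditiveState t) {A : Set X}
    (hA : MeasurableSet[T.measurableSpace] A) :
    stateMeasure ht A = ENNReal.ofReal (t (ind hA)) :=
  @Measure.ofMeasurable_apply X T.measurableSpace _ _ _ A hA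

theorem isProbabilityMeasure_stateMeasure (ht : IsSigmaAdditiveState t) :
    IsProbabilityMeasure (stateMeasure ht) :=
  ⟨by rw [stateMeasure_apply ht .univ, ind_univ, ht.map_one, ENNReal.ofReal_one]⟩

end States

section Integral

theorem integrable_coe (μ : Measure[T.measurableSpace] X) [IsFiniteMeasure μ] (f : T.carrier) :
    Integrable (fun x => (f.1 x : ℝ)) μ := by
  refine .of_bound (measurable_coe f).aestronglyMeasurable 1 (.of_forall fun x => ?_)
  rw [Real.norm_of_nonneg (f.1 x).2.1]
  exact (f.1 x).2.2

theorem integral_ind (μ : Measure[T.measurableSpace] X) {A : Set X}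
    (hA : MeasurableSet[T.measurableSpace] A) : ∫ x, ((ind hA).1 x : ℝ) ∂μ = μ.real A := by
  simp only [coe_ind_apply]
  exact integral_indicator_one hA

theorem isState_integral (μ : Measure[T.measurableSpace] X) [IsProbabilityMeasure μ] :
    IsState fun f : T.carrier => ∫ x, (f.1 x : ℝ) ∂μ where
  mem_Icc f := by
    refine ⟨integral_nonneg fun x => (f.1 x).2.1, ?_⟩
    calc ∫ x, (f.1 x : ℝ) ∂μ ≤ ∫ _, 1 ∂μ :=
          integral_mono (integrable_coe μ f) (integrable_const 1) fun x => (f.1 x).2.2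
      _ = 1 := by simp
  map_one := by simp [coe_one_apply]
  map_sum f g k h := by
    rw [← integral_add (integrable_coe μ f) (integrable_coe μ g)]
    simp only [coe_add_coe_of_isSum h]

theorem existsUnique_eq_integral {t : T.carrier → ℝ} (ht : IsSigmaAdditiveState t) :
    ∃! μ : Measure[T.measurableSpace] X,
      IsProbabilityMeasure μ ∧ ∀ f : T.carrier, t f = ∫ x, (f.1 x : ℝ) ∂μ := by
  refine ⟨stateMeasure ht, ⟨isProbabilityMeasure_stateMeasure ht, ?_⟩, ?_⟩
  · have := isProbabilityMeasure_stateMeasure ht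
    refine congrFun (eq_of_isState_of_eq_ind ht.toIsState (isState_integral (stateMeasure ht)) ?_)
    intro A hA
    rw [integral_ind, measureReal_def, stateMeasure_apply ht hA,
      ENNReal.toReal_ofReal (ht.mem_Icc _).1]
  · rintro μ ⟨hμ, h⟩
    refine @Measure.ext X T.measurableSpace _ _ fun A hA => ?_
    rw [stateMeasure_apply ht hA, h, integral_ind, ofReal_measureReal]

end Integral

end Tribe

theorem mainTheorem7 {M : Type u} [MVAlgebra M] (hM : MVAlgebra.IsSigmaComplete M)
    (s : M → ℝ) (hs : MVAlgebra.IsSigmaAdditiveState s) :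
    ∃ (X : Type u) (_ : Nonempty X) (T : Tribe X) (h : T.carrier → M),
      MVAlgebra.IsSigmaHom h ∧ Function.Surjective h ∧
      T.B₀ = T.S₀ ∧
      ∃ m : MeasurableSpace X,
        {A : Set X | MeasurableSet[m] A} = T.B₀ ∧
        (∀ f : T.carrier, Measurable[m] fun x => (f.1 x : ℝ)) ∧
        ∃! μ : @MeasureTheory.Measure X m,
          MeasureTheory.IsProbabilityMeasure μ ∧
          ∀ (a : M) (f : T.carrier), h f = a → s a = ∫ x, (f.1 x : ℝ) ∂μ := by
  have hhom := MVAlgebra.isSigmaHom_loomisSikorskiHom hM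
  refine ⟨MVAlgebra.Spec M, hs.toIsState.nonempty_spec hM, MVAlgebra.loomisSikorskiTribe hM,
    MVAlgebra.loomisSikorskiHom hM, hhom, MVAlgebra.loomisSikorskiHom_surjective hM,
    Tribe.B₀_eq_S₀ _, (MVAlgebra.loomisSikorskiTribe hM).measurableSpace,
    (Tribe.B₀_eq_S₀ _).symm, Tribe.measurable_coe, ?_⟩
  refine (existsUnique_congr fun μ => and_congr_right fun _ => ?_).1
    (Tribe.existsUnique_eq_integral (hs.comp hhom))
  exact ⟨fun hf a f ha => ha ▸ hf f, fun hf f => hf _ f rfl⟩
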